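/- Let $\Gamma$ be a commutative cancellative monoid (written additively) whose quotient group $\langle\Gamma\rangle=\{a-b : a,b\in\Gamma\}$ is torsion-free, and let $R=\bigoplus_{\alpha\in\Gamma}R_\alpha$ be a $\Gamma$-graded (commutative) integral domain with quotient field $K$. Let $H$ be the multiplicative set of nonzero homogeneous elements of $R$ and $R_H\subseteq K$ the ring of fractions of $R$ with respect to $H$. For $f\in R$ let $C(f)$ be the ideal of $R$ generated by the homogeneous components of $f$. A semistar operation on $R$ is a map $E\mapsto E^\star$ from the set of all nonzero $R$-submodules of $K$ to itself such that, for all $0\neq x\in K$ and all nonzero $R$-submodules $E,F$ of $K$: $(xE)^\star=xE^\star$; $E\subseteq F$ implies $E^\star\subseteq F^\star$; $E\subseteq E^\star$ and $(E^\star)^\star=E^\star$. Given such a $\star$, the set $N_\star(H)=\{0\ne f\in R : C(f)^\star=R^\star\}$ is multiplicative, and the ring of fractions $R_{N_\star(H)}$ is called the $\star$-Nagata ring. For an integral domain $D$, let $\mathrm{Pic}(D)$ be the group of invertible fractional ideals of $D$ modulo its subgroup of nonzero principal fractional ideals. Suppose that $R$ has a unit of nonzero degree, that is, a unit $u\in R_\alpha$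 for some $\alpha\neq 0$, and let $\star$ be a semistar operation on $R$ such that $R^\star\subsetneq R_H$. Then $\mathrm{Pic}(R_{N_\star(H)})=0$. -/

import Mathlib

open scoped Pointwise nonZeroDivisors

/-! ### Semistar operations -/

/-- A nonzero element of a field rescales a nonzero submodule to a nonzero submodule. -/
theorem Submodule.units_smul_ne_bot {R K : Type*} [CommRing R] [Field K] [Algebra R K]
    {x : K} (hx : x ≠ 0) {E : Submodule R K} (hE : E ≠ ⊥) : x • E ≠ ⊥ := by
  obtain ⟨e, he, he0⟩ := (Submodule.ne_bot_iff E).1 hE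
  exact (Submodule.ne_bot_iff _).2
    ⟨x • e, Submodule.smul_mem_pointwise_smul e x E he, smul_ne_zero hx he0⟩

/-- A semistar operation on a domain `R` with quotient field `K`: a self-map `E ↦ E^⋆` of the set of
all nonzero `R`-submodules of `K` such that `(xE)^⋆ = x E^⋆` for `0 ≠ x ∈ K`, such that `E ⊆ F`
implies `E^⋆ ⊆ F^⋆`, and such that `E ⊆ E^⋆` and `(E^⋆)^⋆ = E^⋆`. -/
structure SemistarOperation (R K : Type*) [CommRing R] [Field K] [Algebra R K] where
  /-- The map `E ↦ E^⋆`. -/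
  op : {E : Submodule R K // E ≠ ⊥} → {E : Submodule R K // E ≠ ⊥}
  op_smul : ∀ (x : K) (hx : x ≠ 0) (E : {E : Submodule R K // E ≠ ⊥}),
    (op ⟨x • (E : Submodule R K), Submodule.units_smul_ne_bot hx E.2⟩ : Submodule R K) =
      x • (op E : Submodule R K)
  op_mono : ∀ E F : {E : Submodule R K // E ≠ ⊥}, (E : Submodule R K) ≤ F →
    (op E : Submodule R K) ≤ op F
  le_op : ∀ E : {E : Submodule R K // E ≠ ⊥}, (E : Submodule R K) ≤ op E
  op_op : ∀ E : {E : Submodule R K // E ≠ ⊥}, op (op E) = op E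

namespace SemistarOperation

/-- The `R`-module `R^⋆` (here `1 : Submodule R K` is `R` itself, viewed inside `K`). -/
def ringClosure {R K : Type*} [CommRing R] [Field K] [Algebra R K]
    (s : SemistarOperation R K) : Submodule R K :=
  s.op ⟨1, one_ne_zero⟩

/-- `I^⋆ = R^⋆`, for an ideal `I` of `R`; part of the condition is that `I` is nonzero, since `⋆` is
only defined on nonzero modules. -/
def ClosureEqRing {R K : Type*} [CommRing R] [Field K] [Algebra R K]
    (s : SemistarOperation R K) (I : Ideal R) : Prop :=
  ∃ h : IsLocalization.coeSubmodule K I ≠ ⊥,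
    (s.op ⟨IsLocalization.coeSubmodule K I, h⟩ : Submodule R K) = s.ringClosure

section

variable {R K : Type*} [CommRing R] [Field K] [Algebra R K] {s : SemistarOperation R K}

theorem closureEqRing_top : s.ClosureEqRing (⊤ : Ideal R) := by
  have h : IsLocalization.coeSubmodule K (⊤ : Ideal R) = 1 := IsLocalization.coeSubmodule_top K
  refine ⟨by rw [h]; exact one_ne_zero, ?_⟩
  simp only [h]
  rfl

theorem ClosureEqRing.mono {I J : Ideal R} (hI : s.ClosureEqRing I) (hIJ : I ≤ J) :
    s.ClosureEqRing J := by
  obtain ⟨h, hs⟩ := hI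
  have hle : IsLocalization.coeSubmodule K I ≤ IsLocalization.coeSubmodule K J :=
    IsLocalization.coeSubmodule_mono K hIJ
  have h' : IsLocalization.coeSubmodule K J ≠ ⊥ := fun hb => h (le_bot_iff.1 (hb ▸ hle))
  refine ⟨h', le_antisymm ?_ ?_⟩
  · refine s.op_mono ⟨_, h'⟩ ⟨1, one_ne_zero⟩ ?_
    have := IsLocalization.coeSubmodule_mono K (le_top : J ≤ ⊤)
    rwa [IsLocalization.coeSubmodule_top K] at this
  · rw [← hs]
    exact s.op_mono ⟨_, h⟩ ⟨_, h'⟩ hle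

theorem ClosureEqRing.mul {I J : Ideal R} (hI : s.ClosureEqRing I) (hJ : s.ClosureEqRing J) :
    s.ClosureEqRing (I * J) := by
  obtain ⟨h, hs⟩ := hI
  obtain ⟨h', hs'⟩ := hJ
  have hm : IsLocalization.coeSubmodule K (I * J) =
      IsLocalization.coeSubmodule K I * IsLocalization.coeSubmodule K J :=
    IsLocalization.coeSubmodule_mul K I J
  have hne : IsLocalization.coeSubmodule K (I * J) ≠ ⊥ := by
    rw [hm]
    obtain ⟨a, ha, ha0⟩ := (Submodule.ne_bot_iff _).1 h
    obtain ⟨b, hb, hb0⟩ := (Submodule.ne_bot_iff _).1 h'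
    exact (Submodule.ne_bot_iff _).2 ⟨a * b, Submodule.mul_mem_mul ha hb, mul_ne_zero ha0 hb0⟩
  have key : IsLocalization.coeSubmodule K I ≤ s.op ⟨_, hne⟩ := by
    intro x hx
    by_cases hx0 : x = 0
    · rw [hx0]; exact Submodule.zero_mem _
    have h1 : x ∈ x • s.ringClosure := by
      have : (1 : K) ∈ s.ringClosure :=
        s.le_op ⟨1, one_ne_zero⟩ (Submodule.one_le.1 le_rfl)
      simpa using Submodule.smul_mem_pointwise_smul (1 : K) x _ this
    rw [← hs', ← s.op_smul x hx0 ⟨_, h'⟩] at h1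
    refine s.op_mono _ ⟨_, hne⟩ ?_ h1
    change x • IsLocalization.coeSubmodule K J ≤ IsLocalization.coeSubmodule K (I * J)
    rw [hm]
    rintro _ ⟨y, hy, rfl⟩
    exact Submodule.mul_mem_mul hx hy
  refine ⟨hne, le_antisymm ?_ ?_⟩
  · refine s.op_mono ⟨_, hne⟩ ⟨1, one_ne_zero⟩ ?_
    have := IsLocalization.coeSubmodule_mono K (le_top : I * J ≤ ⊤)
    rwa [IsLocalization.coeSubmodule_top K] at this
  · have := s.op_mono ⟨_, h⟩ (s.op ⟨_, hne⟩) key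
    rwa [s.op_op, hs] at this

theorem ClosureEqRing.pow {I : Ideal R} (hI : s.ClosureEqRing I) (n : ℕ) :
    s.ClosureEqRing (I ^ n) := by
  induction n with
  | zero => rw [pow_zero, Ideal.one_eq_top]; exact closureEqRing_top
  | succ n ih => rw [pow_succ]; exact ih.mul hI

end

end SemistarOperation

/-! ### Graded domains, homogeneous elements and contents -/

namespace GradedDomain

section

variable {Γ R : Type*} [AddCancelCommMonoid Γ] [DecidableEq Γ] [CommRing R]
  (𝒜 : Γ → AddSubgroup R) [GradedRing 𝒜]

/-- The multiplicative set `H` of nonzero homogeneous elements of a graded domain. -/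
def nonzeroHomogeneous [IsDomain R] : Submonoid R where
  carrier := {a | a ≠ 0 ∧ SetLike.IsHomogeneousElem 𝒜 a}
  one_mem' := ⟨one_ne_zero, SetLike.isHomogeneousElem_one 𝒜⟩
  mul_mem' := fun ha hb => ⟨mul_ne_zero ha.1 hb.1, ha.2.mul hb.2⟩

theorem nonzeroHomogeneous_le [IsDomain R] : nonzeroHomogeneous 𝒜 ≤ R⁰ :=
  fun _ ha => mem_nonZeroDivisors_of_ne_zero ha.1

/-- The homogeneous quotient field `R_H` of `R`: the fractions `a / s` in the quotient field `K`
with `a ∈ R` and `s ∈ H`. -/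
noncomputable def homogeneousQuotientField [IsDomain R] (K : Type*) [Field K] [Algebra R K]
    [IsFractionRing R K] : Subalgebra R K :=
  Localization.subalgebra.ofField K (nonzeroHomogeneous 𝒜) (nonzeroHomogeneous_le 𝒜)

/-- The content `C(f)` of `f ∈ R`: the ideal generated by the homogeneous components of `f`. -/
def content (f : R) : Ideal R :=
  Ideal.span (Set.range fun α : Γ => ((DirectSum.decompose 𝒜 f α : 𝒜 α) : R))

theorem component_mem_content (f : R) (α : Γ) :
    ((DirectSum.decompose 𝒜 f α : 𝒜 α) : R) ∈ content 𝒜 f :=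
  Ideal.subset_span ⟨α, rfl⟩

theorem content_zero : content 𝒜 (0 : R) = ⊥ := by
  rw [content, Ideal.span_eq_bot]
  rintro _ ⟨α, rfl⟩
  simp

theorem content_one : content 𝒜 (1 : R) = ⊤ := by
  rw [Ideal.eq_top_iff_one]
  have := component_mem_content 𝒜 (1 : R) 0
  rwa [DirectSum.decompose_of_mem_same 𝒜 (SetLike.GradedOne.one_mem : (1 : R) ∈ 𝒜 0)] at this

theorem content_fg (f : R) : (content 𝒜 f).FG := by
  classical
  have : content 𝒜 f = Ideal.span (((DirectSum.decompose 𝒜 f).support.image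
      fun α : Γ => ((DirectSum.decompose 𝒜 f α : 𝒜 α) : R) : Finset R) : Set R) := by
    refine le_antisymm (Ideal.span_le.2 ?_) (Ideal.span_mono ?_)
    · rintro _ ⟨α, rfl⟩
      by_cases h : DirectSum.decompose 𝒜 f α = 0
      · simp [h]
      · refine Ideal.subset_span ?_
        simp only [Finset.coe_image]
        exact ⟨α, by simpa using h, rfl⟩
    · intro x hx
      simp only [Finset.coe_image] at hx
      obtain ⟨α, -, rfl⟩ := hx
      exact ⟨α, rfl⟩
  rw [this]
  exact ⟨_, rfl⟩

/-- Torsion-free cancellative commutative monoids have unique sums. -/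
theorem uniqueSums_of_torsionFree (Γ : Type*) [AddCancelCommMonoid Γ] [IsAddTorsionFree Γ] :
    UniqueSums Γ where
  uniqueAdd_of_nonempty := by
    classical
    intro A B hA hB
    let M : AddSubmonoid Γ := AddSubmonoid.closure ((A ∪ B : Finset Γ) : Set Γ)
    have hAM : ∀ a ∈ A, a ∈ M := fun a ha =>
      AddSubmonoid.subset_closure (Finset.mem_coe.2 (Finset.mem_union_left _ ha))
    have hBM : ∀ b ∈ B, b ∈ M := fun b hb =>
      AddSubmonoid.subset_closure (Finset.mem_coe.2 (Finset.mem_union_right _ hb))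
    have : AddMonoid.FG M := (AddMonoid.fg_iff_addSubmonoid_fg M).2 ⟨A ∪ B, rfl⟩
    have : IsAddTorsionFree M :=
      Function.Injective.isAddTorsionFree M.subtype Subtype.val_injective
    let _ : AddCancelCommMonoid M :=
      { (inferInstance : AddCommMonoid M) with
        add_left_cancel := fun a b c h =>
          Subtype.ext (add_left_cancel (a := (a : Γ)) (congrArg Subtype.val h)) }
    have : TwoUniqueSums M := AffineAddMonoid.to_twoUniqueSums
    have : UniqueSums M := inferInstance
    obtain ⟨a, ha⟩ := hA
    obtain ⟨b, hb⟩ := hB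
    obtain ⟨a0, ha0, b0, hb0, h⟩ := UniqueSums.uniqueAdd_of_nonempty (G := M)
      (A := A.subtype (· ∈ M)) (B := B.subtype (· ∈ M))
      ⟨⟨a, hAM a ha⟩, Finset.mem_subtype.2 ha⟩ ⟨⟨b, hBM b hb⟩, Finset.mem_subtype.2 hb⟩
    refine ⟨a0, Finset.mem_subtype.1 ha0, b0, Finset.mem_subtype.1 hb0, ?_⟩
    intro x y hx hy hxy
    have := h (a := ⟨x, hAM x hx⟩) (b := ⟨y, hBM y hy⟩) (Finset.mem_subtype.2 hx)
      (Finset.mem_subtype.2 hy) (Subtype.ext hxy)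
    exact ⟨congrArg Subtype.val this.1, congrArg Subtype.val this.2⟩

/-- Over a torsion-free grading monoid a product of contents is contained in the radical of the
content of the product. -/
theorem content_mul_content_le_radical [IsAddTorsionFree Γ] (f g : R) :
    content 𝒜 f * content 𝒜 g ≤ (content 𝒜 (f * g)).radical := by
  classical
  rw [Ideal.radical_eq_sInf]
  refine le_sInf ?_
  rintro P ⟨hP, hPp⟩
  rw [hPp.mul_le]
  by_contra hcon
  have hex : ∀ f : R, ¬ content 𝒜 f ≤ P →
      ((DirectSum.decompose 𝒜 f).support.filter
        fun α => ((DirectSum.decompose 𝒜 f α : 𝒜 α) : R) ∉ P).Nonempty := by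
    intro f hf
    by_contra hne
    refine hf (Ideal.span_le.2 ?_)
    rintro _ ⟨α, rfl⟩
    by_contra hα
    refine hne ⟨α, ?_⟩
    rw [Finset.mem_filter, DFinsupp.mem_support_iff]
    refine ⟨fun h0 => hα ?_, hα⟩
    simp [h0]
  obtain ⟨hf, hg⟩ := not_or.1 hcon
  have := uniqueSums_of_torsionFree Γ
  obtain ⟨a, ha, b, hb, hab⟩ := UniqueSums.uniqueAdd_of_nonempty (hex f hf) (hex g hg)
  have hc := hP (component_mem_content 𝒜 (f * g) (a + b))
  rw [DirectSum.decompose_mul, DirectSum.coe_mul_apply] at hc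
  rw [← Finset.add_sum_erase _ _ (a := (a, b))] at hc
  · have hrest : ∑ ij ∈ (((DirectSum.decompose 𝒜 f).support ×ˢ
        (DirectSum.decompose 𝒜 g).support).filter
          fun ij : Γ × Γ => ij.1 + ij.2 = a + b).erase (a, b),
        (((DirectSum.decompose 𝒜 f ij.1 : 𝒜 ij.1) : R) *
          ((DirectSum.decompose 𝒜 g ij.2 : 𝒜 ij.2) : R)) ∈ P := by
      refine P.sum_mem ?_
      rintro ⟨i, j⟩ hij
      rw [Finset.mem_erase, Finset.mem_filter, Finset.mem_product] at hij
      obtain ⟨hne, ⟨hi, hj⟩, hsum⟩ := hij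
      by_cases h1 : ((DirectSum.decompose 𝒜 f i : 𝒜 i) : R) ∈ P
      · exact P.mul_mem_right _ h1
      by_cases h2 : ((DirectSum.decompose 𝒜 g j : 𝒜 j) : R) ∈ P
      · exact P.mul_mem_left _ h2
      obtain ⟨rfl, rfl⟩ := hab (Finset.mem_filter.2 ⟨hi, h1⟩) (Finset.mem_filter.2 ⟨hj, h2⟩) hsum
      exact absurd rfl hne
    rcases hPp.mem_or_mem ((P.add_mem_iff_left hrest).1 hc) with h | h
    · exact (Finset.mem_filter.1 ha).2 h
    · exact (Finset.mem_filter.1 hb).2 h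
  · rw [Finset.mem_filter, Finset.mem_product]
    exact ⟨⟨(Finset.mem_filter.1 ha).1, (Finset.mem_filter.1 hb).1⟩, rfl⟩

end

/-! ### The Nagata ring -/

section

variable {Γ R K : Type*} [AddCancelCommMonoid Γ] [IsAddTorsionFree Γ] [DecidableEq Γ]
  [CommRing R] [Field K] [Algebra R K]
  (𝒜 : Γ → AddSubgroup R) [GradedRing 𝒜] (s : SemistarOperation R K)

/-- The multiplicative set `N_⋆(H) = {f ∈ R | C(f)^⋆ = R^⋆}`. -/
def nagataSet : Submonoid R where
  carrier := {f | s.ClosureEqRing (content 𝒜 f)}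
  one_mem' := by
    change s.ClosureEqRing (content 𝒜 1)
    rw [content_one]
    exact SemistarOperation.closureEqRing_top
  mul_mem' := by
    intro f g hf hg
    obtain ⟨n, hn⟩ := Ideal.exists_pow_le_of_le_radical_of_fg
      (content_mul_content_le_radical 𝒜 f g) ((content_fg 𝒜 f).mul (content_fg 𝒜 g))
    exact ((hf.mul hg).pow n).mono hn

theorem nagataSet_le [IsDomain R] : nagataSet 𝒜 s ≤ R⁰ := by
  rintro f ⟨h, -⟩
  refine mem_nonZeroDivisors_of_ne_zero ?_
  rintro rfl
  refine h ?_
  rw [content_zero]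
  exact IsLocalization.coeSubmodule_bot K

/-- The `⋆`-Nagata ring `R_{N_⋆(H)}`: the fractions `a / f` in the quotient field `K` of `R` with
`a ∈ R` and `f ∈ N_⋆(H)`. -/
noncomputable def nagataRing [IsDomain R] [IsFractionRing R K] : Subalgebra R K :=
  Localization.subalgebra.ofField K (nagataSet 𝒜 s) (nagataSet_le 𝒜 s)

end

end GradedDomain

namespace GradedDomain

/-! This is Kronecker's trick, with a unit `u` of nonzero degree as the indeterminate. If `I * J =
1` over the Nagata ring, write `1 = ∑ x_i y_i` and clear denominators: `t x_j y_i = a_ij` lies in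
`R` for some `t ∈ N_⋆(H)`. Put `f = ∑ u^(B j) x_j` and `g = ∑ u^(B n i) y_i`, so that `t f g = h`
with `h = ∑ u^(B (j + n i)) a_ij`. For large `B` the summands of `h` have disjoint supports
(`exists_content_le_content_sum_pow_mul`), so `C(h)` contains every `C(a_ij)`, hence `C(t)`, because
`t = ∑ a_ii`. Thus `h ∈ N_⋆(H)`, `f g = h / t` is a unit of the Nagata ring, and `f` generates `I`
(`isPrincipal_of_mul_eq_one`). -/

/-- Finitely many degrees are separated by large multiples of a nonzero degree. -/
theorem exists_forall_le_ne_nsmul_add {Γ : Type*} [AddCancelCommMonoid Γ]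
    [IsAddTorsionFree Γ] {α : Γ} (hα : α ≠ 0) (T : Finset Γ) :
    ∃ B : ℕ, ∀ β ∈ T, ∀ γ ∈ T, ∀ c, B ≤ c → β ≠ c • α + γ := by
  classical
  have h : ∀ p : Γ × Γ, ∃ b : ℕ, ∀ c, b ≤ c → p.1 ≠ c • α + p.2 := by
    intro p
    by_cases hp : ∃ c : ℕ, p.1 = c • α + p.2
    · obtain ⟨c, hc⟩ := hp
      -- Multiples of `α` are pairwise distinct by torsion-freeness, so cancellation leaves `c` as
      -- the only solution; the bound starts just past it.
      refine ⟨c + 1, fun d hd hd' => ?_⟩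
      have := injective_nsmul_iff_not_isOfFinAddOrder.2
        (not_isOfFinAddOrder_of_isAddTorsionFree hα) (add_right_cancel (hc.symm.trans hd'))
      omega
    · exact ⟨0, fun c _ hc => hp ⟨c, hc⟩⟩
  choose b hb using h
  refine ⟨(T ×ˢ T).sup b, fun β hβ γ hγ c hc => hb (β, γ) c ?_⟩
  exact (Finset.le_sup (f := b) (Finset.mk_mem_product hβ hγ)).trans hc

/-! ### Contents of sums of shifted elements -/

section Content

variable {Γ R : Type*} [AddCancelCommMonoid Γ] [DecidableEq Γ] [CommRing R]
  (𝒜 : Γ → AddSubgroup R) [GradedRing 𝒜]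

theorem content_le_iff {f : R} {J : Ideal R} :
    content 𝒜 f ≤ J ↔ ∀ α : Γ, ((DirectSum.decompose 𝒜 f α : 𝒜 α) : R) ∈ J := by
  rw [content, Ideal.span_le, Set.range_subset_iff]
  rfl

theorem coe_decompose_sum {ι : Type*} (t : Finset ι) (f : ι → R) (α : Γ) :
    ((DirectSum.decompose 𝒜 (∑ i ∈ t, f i) α : 𝒜 α) : R) =
      ∑ i ∈ t, ((DirectSum.decompose 𝒜 (f i) α : 𝒜 α) : R) := by
  rw [DirectSum.decompose_sum, DFinsupp.finsetSum_apply, AddSubgroup.val_finsetSum]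

theorem content_sum_le {ι : Type*} {t : Finset ι} {f : ι → R} {J : Ideal R}
    (h : ∀ i ∈ t, content 𝒜 (f i) ≤ J) : content 𝒜 (∑ i ∈ t, f i) ≤ J := by
  rw [content_le_iff]
  intro α
  rw [coe_decompose_sum]
  exact J.sum_mem fun i hi => (content_le_iff 𝒜).1 (h i hi) α

theorem content_mul_le_right (f g : R) : content 𝒜 (f * g) ≤ content 𝒜 g := by
  classical
  rw [content_le_iff]
  intro α
  rw [DirectSum.decompose_mul, DirectSum.coe_mul_apply]
  exact Ideal.sum_mem _ fun ij _ => Ideal.mul_mem_left _ _ (component_mem_content 𝒜 g ij.2)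

theorem exists_add_eq_of_decompose_mul_ne_zero {v f : R} {δ γ : Γ} (hv : v ∈ 𝒜 δ)
    (h : ((DirectSum.decompose 𝒜 (v * f) γ : 𝒜 γ) : R) ≠ 0) :
    ∃ β, ((DirectSum.decompose 𝒜 f β : 𝒜 β) : R) ≠ 0 ∧ γ = δ + β := by
  classical
  rw [← DirectSum.sum_support_decompose 𝒜 f, Finset.mul_sum, coe_decompose_sum] at h
  obtain ⟨β, hβ, hne⟩ := Finset.exists_ne_zero_of_sum_ne_zero h
  refine ⟨β, ?_, ?_⟩
  · intro h0
    simp [h0] at hne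
  · by_contra hγ
    exact hne (DirectSum.decompose_of_mem_ne 𝒜
      (SetLike.mul_mem_graded hv (DirectSum.decompose 𝒜 f β).2) (Ne.symm hγ))

/-- Shifting finitely many elements by suitable powers of a unit of nonzero degree makes their
supports disjoint, so that no cancellation occurs in the content of the sum. -/
theorem exists_content_le_content_sum_pow_mul [IsAddTorsionFree Γ] {u : R} (hu : IsUnit u) {α : Γ}
    (hα : α ≠ 0) (huα : u ∈ 𝒜 α) {ι : Type*} [Fintype ι] (a : ι → R) {e : ι → ℕ}
    (he : Function.Injective e) :
    ∃ B : ℕ, ∀ i, content 𝒜 (a i) ≤ content 𝒜 (∑ j, u ^ (B * e j) * a j) := by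
  classical
  obtain ⟨B, hB⟩ := exists_forall_le_ne_nsmul_add hα
    (Finset.univ.biUnion fun i => (DirectSum.decompose 𝒜 (a i)).support)
  have hT : ∀ i β, ((DirectSum.decompose 𝒜 (a i) β : 𝒜 β) : R) ≠ 0 →
      β ∈ Finset.univ.biUnion fun i => (DirectSum.decompose 𝒜 (a i)).support := by
    intro i β hβ
    refine Finset.mem_biUnion.2 ⟨i, Finset.mem_univ i, DFinsupp.mem_support_iff.2 fun h0 => hβ ?_⟩
    simp [h0]
  have hpow : ∀ k : ℕ, u ^ k ∈ 𝒜 (k • α) := fun k => SetLike.pow_mem_graded k huα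
  -- Cancelling `(B * m) • α` leaves a gap `B * (n - m)`, which is at least `B`.
  have hsep : ∀ {β γ : Γ} {m n : ℕ}, (∀ c, B ≤ c → β ≠ c • α + γ) → m < n →
      (B * m) • α + β ≠ (B * n) • α + γ := by
    intro β γ m n h hmn heq
    obtain ⟨d, rfl⟩ := Nat.exists_eq_add_of_lt hmn
    refine h (B * (d + 1)) (Nat.le_mul_of_pos_right _ (Nat.succ_pos d)) ?_
    rw [show B * (m + d + 1) = B * m + B * (d + 1) by ring, add_nsmul, add_assoc] at heq
    exact add_left_cancel heq
  refine ⟨B, fun i => (content_le_iff 𝒜).2 fun β => ?_⟩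
  by_cases hβ : ((DirectSum.decompose 𝒜 (a i) β : 𝒜 β) : R) = 0
  · rw [hβ]
    exact Ideal.zero_mem _
  -- In this degree only the `i`-th summand survives; its component is a power of `u` times the
  -- degree-`β` component of `a i`, and the unit can be stripped off.
  have hmem := component_mem_content 𝒜 (∑ j, u ^ (B * e j) * a j) ((B * e i) • α + β)
  set J := content 𝒜 (∑ j, u ^ (B * e j) * a j)
  rw [coe_decompose_sum, Finset.sum_eq_single i] at hmem
  · rw [DirectSum.coe_decompose_mul_add_of_left_mem 𝒜 (hpow _)] at hmem
    exact (Ideal.unit_mul_mem_iff_mem _ (hu.pow _)).1 hmem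
  · intro j _ hji
    by_contra hne
    obtain ⟨γ, hγ, heq⟩ := exists_add_eq_of_decompose_mul_ne_zero 𝒜 (hpow _) hne
    rcases lt_or_gt_of_ne (he.ne hji) with hlt | hlt
    · exact hsep (hB γ (hT j γ hγ) β (hT i β hβ)) hlt heq.symm
    · exact hsep (hB β (hT i β hβ) γ (hT j γ hγ)) hlt heq
  · exact fun h => absurd (Finset.mem_univ i) h

end Content

end GradedDomain

/-- Indexing by `Fin n` lets pairs of indices be encoded as distinct natural exponents. -/
theorem Submodule.exists_fin_sum_mul_of_mem_mul {A K : Type*} [CommSemiring A] [Semiring K]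
    [Algebra A K] {I J : Submodule A K} {z : K} (hz : z ∈ I * J) :
    ∃ (n : ℕ) (x y : Fin n → K), (∀ i, x i ∈ I) ∧ (∀ i, y i ∈ J) ∧ z = ∑ i, x i * y i := by
  induction hz using Submodule.mul_induction_on' with
  | mem_mul_mem x hx y hy => exact ⟨1, fun _ => x, fun _ => y, fun _ => hx, fun _ => hy, by simp⟩
  | add z _ w _ hz hw =>
    obtain ⟨n, x, y, hx, hy, rfl⟩ := hz
    obtain ⟨m, x', y', hx', hy', rfl⟩ := hw
    refine ⟨n + m, Fin.append x x', Fin.append y y', ?_, ?_, ?_⟩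
    · exact fun i => Fin.addCases (fun j => by simpa using hx j) (fun j => by simpa using hx' j) i
    · exact fun i => Fin.addCases (fun j => by simpa using hy j) (fun j => by simpa using hy' j) i
    · simp [Fin.sum_univ_add]

namespace GradedDomain

/-! ### Invertible modules over the Nagata ring -/

section Nagata

variable {Γ R K : Type*} [AddCancelCommMonoid Γ] [IsAddTorsionFree Γ] [DecidableEq Γ]
  [CommRing R] [IsDomain R] [Field K] [Algebra R K] [IsFractionRing R K]
  (𝒜 : Γ → AddSubgroup R) [GradedRing 𝒜] (s : SemistarOperation R K)

theorem mem_nagataRing_iff {x : K} :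
    x ∈ nagataRing 𝒜 s ↔
      ∃ a t : R, ∃ _ : t ∈ nagataSet 𝒜 s, x = algebraMap R K a * (algebraMap R K t)⁻¹ :=
  Iff.rfl

theorem algebraMap_ne_zero_of_mem_nagataSet {t : R} (ht : t ∈ nagataSet 𝒜 s) :
    algebraMap R K t ≠ 0 :=
  IsFractionRing.to_map_ne_zero_of_mem_nonZeroDivisors (nagataSet_le 𝒜 s ht)

/-- A finite family in the Nagata ring has a common denominator. -/
theorem exists_common_denominator {ι : Type*} [Fintype ι] (x : ι → K)
    (hx : ∀ i, x i ∈ nagataRing 𝒜 s) :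
    ∃ t ∈ nagataSet 𝒜 s, ∃ a : ι → R, ∀ i, algebraMap R K t * x i = algebraMap R K (a i) := by
  have : IsLocalization (nagataSet 𝒜 s) (nagataRing 𝒜 s) :=
    Localization.subalgebra.isLocalization_ofField K _ (nagataSet_le 𝒜 s)
  obtain ⟨t, ht⟩ := IsLocalization.exist_integer_multiples (nagataSet 𝒜 s) Finset.univ
    fun i => (⟨x i, hx i⟩ : nagataRing 𝒜 s)
  choose a ha using fun i => ht i (Finset.mem_univ i)
  refine ⟨t, t.2, a, fun i => ?_⟩
  have := congrArg (Subtype.val : nagataRing 𝒜 s → K) (ha i)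
  rw [← Algebra.smul_def]
  exact this.symm

theorem isPrincipal_of_mul_eq_one {u : R} (hu : IsUnit u) {α : Γ} (hα : α ≠ 0) (huα : u ∈ 𝒜 α)
    {I J : Submodule (nagataRing 𝒜 s) K} (hIJ : I * J = 1) : I.IsPrincipal := by
  have hmem : ∀ {x y : K}, x ∈ I → y ∈ J → x * y ∈ nagataRing 𝒜 s := by
    intro x y hx hy
    have h := Submodule.mul_mem_mul hx hy
    rw [hIJ] at h
    obtain ⟨z, hz⟩ := Submodule.mem_one.1 h
    rw [← hz]
    exact z.2
  obtain ⟨n, x, y, hx, hy, hxy⟩ := Submodule.exists_fin_sum_mul_of_mem_mul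
    (show (1 : K) ∈ I * J from hIJ ▸ Submodule.one_le.1 le_rfl)
  obtain ⟨t, ht, a, ha⟩ := exists_common_denominator 𝒜 s
    (fun ij : Fin n × Fin n => x ij.2 * y ij.1) fun ij => hmem (hx ij.2) (hy ij.1)
  -- `finProdFinEquiv (i, j)` has value `j + n * i`, so the power of `u` splits into a factor for `x
  -- j` and one for `y i`.
  obtain ⟨B, hB⟩ := exists_content_le_content_sum_pow_mul 𝒜 hu hα huα a
    (e := fun ij => (finProdFinEquiv ij : ℕ))
    (Fin.val_injective.comp finProdFinEquiv.injective)
  set h : R := ∑ ij : Fin n × Fin n, u ^ (B * (finProdFinEquiv ij : ℕ)) * a ij with h_def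
  -- The diagonal terms are `t` times the relation `1 = ∑ x i * y i`.
  have hta : t = ∑ i, a (i, i) := by
    apply IsFractionRing.injective R K
    rw [map_sum, ← mul_one (algebraMap R K t), hxy, Finset.mul_sum]
    exact Finset.sum_congr rfl fun i _ => ha (i, i)
  have hh : h ∈ nagataSet 𝒜 s := by
    refine SemistarOperation.ClosureEqRing.mono ht ?_
    rw [hta]
    exact content_sum_le 𝒜 fun i _ => hB (i, i)
  have smulI : ∀ {L : Submodule (nagataRing 𝒜 s) K} (r : R) {z : K}, z ∈ L →
      algebraMap R K r * z ∈ L := fun {L} r z hz => by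
    have := L.smul_mem (algebraMap R (nagataRing 𝒜 s) r) hz
    rwa [Algebra.smul_def] at this
  let f : K := ∑ i : Fin n, algebraMap R K (u ^ (B * (i : ℕ))) * x i
  let g : K := ∑ i : Fin n, algebraMap R K (u ^ (B * (n * (i : ℕ)))) * y i
  have hf : f ∈ I := Submodule.sum_mem _ fun i _ => smulI _ (hx i)
  have hg : g ∈ J := Submodule.sum_mem _ fun i _ => smulI _ (hy i)
  have hfg : algebraMap R K t * (f * g) = algebraMap R K h := by
    rw [h_def, map_sum, Fintype.sum_prod_type_right, Finset.sum_mul, Finset.mul_sum]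
    refine Finset.sum_congr rfl fun i _ => ?_
    rw [Finset.mul_sum, Finset.mul_sum]
    refine Finset.sum_congr rfl fun j _ => ?_
    rw [map_mul, ← ha (j, i), finProdFinEquiv_apply_val, mul_add, pow_add, map_mul]
    ring
  have ht0 := algebraMap_ne_zero_of_mem_nagataSet 𝒜 s ht
  have hh0 := algebraMap_ne_zero_of_mem_nagataSet 𝒜 s hh
  have hinv : algebraMap R K t * (algebraMap R K h)⁻¹ ∈ nagataRing 𝒜 s :=
    (mem_nagataRing_iff 𝒜 s).2 ⟨t, h, hh, rfl⟩
  -- Since `f * g = h / t`, each `z ∈ I` equals `(z * g * (t / h)) * f`, and `z * g` lies in `I * J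
  -- = 1`.
  refine ⟨⟨f, le_antisymm (fun z hz => ?_) ((Submodule.span_singleton_le_iff_mem _ _).2 hf)⟩⟩
  refine Submodule.mem_span_singleton.2
    ⟨⟨z * g * (algebraMap R K t * (algebraMap R K h)⁻¹), mul_mem (hmem hz hg) hinv⟩, ?_⟩
  change z * g * (algebraMap R K t * (algebraMap R K h)⁻¹) * f = z
  calc z * g * (algebraMap R K t * (algebraMap R K h)⁻¹) * f
      = z * (algebraMap R K t * (f * g)) * (algebraMap R K h)⁻¹ := by ring
    _ = z := by rw [hfg, mul_assoc, mul_inv_cancel₀ hh0, mul_one]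

end Nagata

end GradedDomain

theorem theorem2p11 {Γ R K : Type*} [AddCancelCommMonoid Γ] [IsAddTorsionFree Γ] [DecidableEq Γ]
    [CommRing R] [IsDomain R] [Field K] [Algebra R K] [IsFractionRing R K]
    (𝒜 : Γ → AddSubgroup R) [GradedRing 𝒜]
    (hunit : ∃ u : R, IsUnit u ∧ ∃ α : Γ, α ≠ 0 ∧ u ∈ 𝒜 α)
    (s : SemistarOperation R K)
    (hs : s.ringClosure <
      Subalgebra.toSubmodule (GradedDomain.homogeneousQuotientField 𝒜 K)) :
    Subsingleton (ClassGroup (GradedDomain.nagataRing 𝒜 s)) := by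
  obtain ⟨u, hu, α, hα, huα⟩ := hunit
  -- Ideal classes of the Nagata ring can then be represented by invertible fractional ideals inside
  -- `K`.
  have : IsFractionRing (GradedDomain.nagataRing 𝒜 s) K :=
    Localization.subalgebra.isFractionRing_ofField K _ (GradedDomain.nagataSet_le 𝒜 s)
  refine subsingleton_of_forall_eq 1 (ClassGroup.induction K fun I => ?_)
  rw [ClassGroup.mk_eq_one_iff]
  refine GradedDomain.isPrincipal_of_mul_eq_one 𝒜 s hu hα huα
    (J := ((I⁻¹).val : Submodule (GradedDomain.nagataRing 𝒜 s) K)) ?_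
  rw [← FractionalIdeal.coe_mul, Units.mul_inv, FractionalIdeal.coe_one]
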